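/- Let $\mathrm{ex}(n,K_r)$ denote the maximum number of edges in a graph on $n$ vertices containing no complete subgraph $K_r$. Call an edge-colored graph rainbow if its edges have pairwise distinct colors, monochromatic if all its edges have the same color, and call a complete graph $K_t$ LEX-colored if its vertices can be ordered as $v_1,\dots,v_t$ so that, for suitable pairwise distinct colors $c_2,\dots,c_t$, every edge $v_iv_j$ with $1\le i<j\le t$ has color $c_j$. Theorem (Canonical Cut Lemma). For any integers $r\ge 2$ and $t\ge 2$ there exists a function $h(n)=h(n,r,t)$ with $h(n)=o(n^2)$ as $n\to\infty$ and the following property. For every $n$, every edge coloring $\psi$ of $K_n$ (not necessarily proper) with more than $\mathrm{ex}(n,K_r)+h(n)$ colors contains a complete $r$-partite graph $K\cong K_{t,\dots,t}$, with pairwise disjoint vertex classes $V_1,\dots,V_r$ of $t$ vertices each, such that (i) $K$ is rainbow; (ii) for each $i=1,\dots,r$ the complete graph $K_t$ induced by $V_i$ is monochromatic, rainbow or LEX-colored; (iii) no color occurring on an edge of $K$ occurs on an edge of $K_n$ inside any $V_i$. -/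

import Mathlib

namespace CanonicalCut

open SimpleGraph

/-- The complete multipartite graph with vertex classes `P i`: distinct vertices `u`, `v` are
adjacent when they lie in classes with different indices. (The classes are required to be
pairwise disjoint where this is used.) -/
def multipartiteOn {V ι : Type*} (P : ι → Finset V) : SimpleGraph V :=
  SimpleGraph.fromRel fun u v => ∃ i j, i ≠ j ∧ u ∈ P i ∧ v ∈ P j

/-- The complete graph on the vertex set `S`, as a graph on the ambient vertex type. -/
def cliqueOn {V : Type*} (S : Finset V) : SimpleGraph V :=
  SimpleGraph.fromRel fun u v => u ∈ S ∧ v ∈ S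

/-- The set of all colors used by the edge coloring `ψ`. -/
def colors {V C : Type*} (ψ : TopEdgeLabeling V C) : Set C :=
  Set.range ψ

/-- The set of colors that `ψ` assigns to the edges of the graph `H`. -/
def colorsOn {V C : Type*} (ψ : TopEdgeLabeling V C) (H : SimpleGraph V) : Set C :=
  {c | ∃ (u v : V) (huv : u ≠ v), H.Adj u v ∧ ψ.get u v huv = c}

/-- `H` is rainbow under `ψ`: distinct edges of `H` have distinct colors. -/
def IsRainbowOn {V C : Type*} (ψ : TopEdgeLabeling V C) (H : SimpleGraph V) : Prop :=
  Set.InjOn ψ {e | (e : Sym2 V) ∈ H.edgeSet}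

/-- `H` is monochromatic under `ψ`: all edges of `H` have the same color. -/
def IsMonochromaticOn {V C : Type*} (ψ : TopEdgeLabeling V C) (H : SimpleGraph V) : Prop :=
  ∃ c : C, ∀ e : (⊤ : SimpleGraph V).edgeSet, (e : Sym2 V) ∈ H.edgeSet → ψ e = c

/-- The complete graph on `S` is LEX-colored under `ψ`: the vertices of `S` can be listed as
`v 0, v 1, …, v (m - 1)` so that, for `i < j`, the edge `v i v j` has the color `c j`, where
`c 1, …, c (m - 1)` are pairwise distinct colors. -/
def IsLexOn {V C : Type*} (ψ : TopEdgeLabeling V C) (S : Finset V) : Prop :=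
  ∃ (v : Fin S.card ↪ V) (c : Fin S.card → C),
    Set.range v = (S : Set V) ∧
    Set.InjOn c {j | 0 < (j : ℕ)} ∧
    ∀ (i j : Fin S.card) (hij : i < j), ψ.get (v i) (v j) (v.injective.ne hij.ne) = c j

end CanonicalCut

namespace CanonicalCut

open SimpleGraph Finset Filter

/-! Take `h n` to be the difference between the extremal numbers of the complete `r`-partite graph
with parts of a large constant size and of `K_r`; it is `o(n²)` by Erdős–Stone. One edge of each
color forms a rainbow graph with more edges than the first extremal number, so it contains that
`r`-partite graph (`exists_rainbow_copy`).

Two cleanings follow. Each part is cut into `m` blocks and one vertex is picked per block so that no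
crossing color recurs inside a part (`exists_subparts_avoiding`). The Erdős–Rado theorem inside each
remaining part then gives (ii) (`exists_canonical_subset`), while (i) and (iii) pass to subsets.

Both the block selection and the rainbow case of Erdős–Rado are instances of
`exists_forall_pairColor_ne`, a union bound over quadruples of coordinates. -/

/-- Union bound: if each family `bad τ` is controlled by the single coordinate `k τ`, in the sense
that whatever the other coordinates are, fewer than a `1 / card T` fraction of the values of that
coordinate lead into `bad τ`, then some function avoids all the families. -/
theorem exists_forall_notMem_of_card_update_lt {ι X T : Type*} [Fintype ι] [DecidableEq ι]
    [Fintype X] [Fintype T] (bad : T → Set (ι → X)) (k : T → ι) [∀ τ, DecidablePred (· ∈ bad τ)]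
    (hX : 0 < Fintype.card X)
    (h : ∀ τ f, Fintype.card T * #{x | Function.update f (k τ) x ∈ bad τ} < Fintype.card X) :
    ∃ f, ∀ τ, f ∉ bad τ := by
  classical
  have : Nonempty X := Fintype.card_pos_iff.mp hX
  rcases isEmpty_or_nonempty T with hT | ⟨⟨τ₀⟩⟩
  · exact ⟨fun _ => Classical.arbitrary X, fun τ => isEmptyElim τ⟩
  have hTpos : 0 < Fintype.card T := Fintype.card_pos_iff.mpr ⟨τ₀⟩
  set N := Fintype.card ι - 1 with hN
  have hNs : Fintype.card ι = N + 1 := by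
    have : 0 < Fintype.card ι := Fintype.card_pos_iff.mpr ⟨k τ₀⟩
    omega
  -- The largest integer with `card T * b < card X`; subtracting 1 keeps the inequality strict.
  set b := (Fintype.card X - 1) / Fintype.card T with hb
  have hbT : Fintype.card T * b < Fintype.card X := by
    have : Fintype.card T * b ≤ _ := Nat.mul_div_le (Fintype.card X - 1) (Fintype.card T)
    omega
  have hcard : ∀ τ, #{f | f ∈ bad τ} ≤ b * Fintype.card X ^ N := by
    intro τ
    -- Forgetting coordinate `k τ` splits the functions into lines, each with at most `b` bad
    -- points.
    let g : (ι → X) → ({i // i ≠ k τ} → X) := fun f i => f i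
    have h1 : #{f | f ∈ bad τ} ≤ b * #(({f | f ∈ bad τ} : Finset (ι → X)).image g) := by
      refine card_le_mul_card_image _ _ fun y hy => ?_
      obtain ⟨f₀, -, rfl⟩ := mem_image.mp hy
      have key : ∀ f, g f = g f₀ → f = Function.update f₀ (k τ) (f (k τ)) := by
        intro f hf
        ext i
        by_cases hi : i = k τ
        · subst hi; simp
        · simpa [hi] using congrFun hf ⟨i, hi⟩
      have h2 : #{f ∈ ({f | f ∈ bad τ} : Finset (ι → X)) | g f = g f₀}
          ≤ #{x | Function.update f₀ (k τ) x ∈ bad τ} := by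
        refine card_le_card_of_injOn (fun f => f (k τ)) ?_ ?_
        · intro f hf
          simp only [coe_filter, mem_filter, mem_univ, true_and, Set.mem_ofPred_eq] at hf ⊢
          rw [← key f hf.2]
          exact hf.1
        · intro f hf f' hf' hff
          simp only [coe_filter, mem_filter, mem_univ, true_and, Set.mem_ofPred_eq] at hf hf' hff
          rw [key f hf.2, key f' hf'.2, hff]
      refine h2.trans ?_
      rw [hb, Nat.le_div_iff_mul_le hTpos, mul_comm]
      have := h τ f₀
      omega
    refine h1.trans (Nat.mul_le_mul_left _ ((card_le_univ _).trans ?_))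
    rw [Fintype.card_fun, Fintype.card_subtype_compl, Fintype.card_subtype_eq]
  by_contra! hcon
  have hcover : (univ : Finset (ι → X)) ⊆ univ.biUnion fun τ => ({f | f ∈ bad τ} : Finset _) := by
    intro f _
    simpa using hcon f
  have h3 := (card_le_card hcover).trans (card_biUnion_le_card_mul _ _ _ fun τ _ => hcard τ)
  rw [card_univ, card_univ, Fintype.card_fun, hNs, pow_succ, ← mul_assoc, mul_comm] at h3
  exact absurd (Nat.le_of_mul_le_mul_right h3 (pow_pos hX N)) (not_le.mpr hbT)

/-! ### Colors of pairs -/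

variable {V C : Type*}

open Classical in
/-- The color of the pair `u v` under `ψ`, with the value `none` on the diagonal. -/
noncomputable def pairColor (ψ : TopEdgeLabeling V C) (u v : V) : Option C :=
  if h : u ≠ v then some (ψ.get u v h) else none

theorem pairColor_of_ne (ψ : TopEdgeLabeling V C) {u v : V} (h : u ≠ v) :
    pairColor ψ u v = some (ψ.get u v h) := by
  simp [pairColor, h]

theorem pairColor_eq_none {ψ : TopEdgeLabeling V C} {u v : V} :
    pairColor ψ u v = none ↔ u = v := by
  simp [pairColor]

theorem pairColor_comm (ψ : TopEdgeLabeling V C) (u v : V) :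
    pairColor ψ u v = pairColor ψ v u := by
  by_cases h : u = v
  · rw [h]
  · rw [pairColor_of_ne ψ h, pairColor_of_ne ψ (Ne.symm h), EdgeLabeling.get_comm]

theorem isRainbowOn_iff {ψ : TopEdgeLabeling V C} {H : SimpleGraph V} :
    IsRainbowOn ψ H ↔ ∀ a b c d, H.Adj a b → H.Adj c d →
      pairColor ψ a b = pairColor ψ c d → s(a, b) = s(c, d) := by
  constructor
  · intro h a b c d hab hcd heq
    rw [pairColor_of_ne ψ hab.ne, pairColor_of_ne ψ hcd.ne, Option.some_inj] at heq
    exact congrArg Subtype.val (@h ⟨s(a, b), hab.ne⟩ hab ⟨s(c, d), hcd.ne⟩ hcd heq)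
  · rintro h ⟨e, he⟩ heH ⟨f, hf⟩ hfH heq
    induction e using Sym2.inductionOn with | _ a b
    induction f using Sym2.inductionOn with | _ c d
    have hab : H.Adj a b := heH
    have hcd : H.Adj c d := hfH
    refine Subtype.ext (h a b c d hab hcd ?_)
    rw [pairColor_of_ne ψ hab.ne, pairColor_of_ne ψ hcd.ne, Option.some_inj]
    exact heq

theorem IsRainbowOn.mono {ψ : TopEdgeLabeling V C} {H K : SimpleGraph V} (hle : H ≤ K)
    (h : IsRainbowOn ψ K) : IsRainbowOn ψ H :=
  Set.InjOn.mono (fun _ he => edgeSet_mono hle he) h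

theorem cliqueOn_adj {S : Finset V} {u v : V} :
    (cliqueOn S).Adj u v ↔ u ≠ v ∧ u ∈ S ∧ v ∈ S := by
  simp only [cliqueOn, fromRel_adj]
  tauto

theorem multipartiteOn_adj {ι : Type*} {P : ι → Finset V} {u v : V} :
    (multipartiteOn P).Adj u v ↔ u ≠ v ∧ ∃ i j, i ≠ j ∧ u ∈ P i ∧ v ∈ P j := by
  simp only [multipartiteOn, fromRel_adj]
  refine and_congr_right fun _ => ⟨?_, Or.inl⟩
  rintro (h | ⟨i, j, hij, hv, hu⟩)
  exacts [h, ⟨j, i, hij.symm, hu, hv⟩]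

theorem isMonochromaticOn_cliqueOn {ψ : TopEdgeLabeling V C} {S : Finset V} {c : C}
    (h : ∀ u ∈ S, ∀ v ∈ S, u ≠ v → pairColor ψ u v = some c) :
    IsMonochromaticOn ψ (cliqueOn S) := by
  refine ⟨c, ?_⟩
  rintro ⟨e, he⟩ heS
  induction e using Sym2.inductionOn with | _ a b
  obtain ⟨hab, ha, hb⟩ := cliqueOn_adj.mp heS
  have := h a ha b hb hab
  rw [pairColor_of_ne ψ hab, Option.some_inj] at this
  exact this

theorem isLexOn_of_forall_lt {ψ : TopEdgeLabeling V C} {t : ℕ} {S : Finset V} (hS : #S = t)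
    (v : Fin t → V) (hv : Function.Injective v) (hr : Set.range v = S) (c : Fin t → C)
    (hc : Function.Injective c) (h : ∀ i j, i < j → pairColor ψ (v i) (v j) = some (c j)) :
    IsLexOn ψ S := by
  subst hS
  refine ⟨⟨v, hv⟩, c, hr, hc.injOn, fun i j hij => ?_⟩
  have := h i j hij
  rwa [pairColor_of_ne ψ (hv.ne hij.ne), Option.some_inj] at this

open Classical in
/-- One value of every coordinate can be chosen so that no two pairs of the chosen vertices have
the same color, as long as the second pair has a vertex `w` off the first one and its
other vertex sends only few edges of each color to the candidates for `w`. -/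
theorem exists_forall_pairColor_ne (ψ : TopEdgeLabeling V C) {ι X : Type*} [Fintype ι] [Fintype X]
    (p : ι → X → V) (R : ι → ι → Prop) (hX : 0 < Fintype.card X)
    (h : ∀ z w, z ≠ w → R z w → ∀ x c,
      Fintype.card ι ^ 4 * #{y | pairColor ψ (p z x) (p w y) = c} < Fintype.card X) :
    ∃ f : ι → X, ∀ a b z w, w ≠ a → w ≠ b → w ≠ z → R z w →
      pairColor ψ (p a (f a)) (p b (f b)) ≠ pairColor ψ (p z (f z)) (p w (f w)) := by
  obtain ⟨f, hf⟩ := exists_forall_notMem_of_card_update_lt (ι := ι) (X := X)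
    -- For a quadruple `(a, b, z, w)`, changing coordinate `w` alone moves only the second pair, so
    -- the bad values lie in one color class at the vertex chosen for `z`.
    (T := ι × ι × ι × ι)
    (fun τ => {f | τ.2.2.2 ≠ τ.1 ∧ τ.2.2.2 ≠ τ.2.1 ∧ τ.2.2.2 ≠ τ.2.2.1 ∧ R τ.2.2.1 τ.2.2.2 ∧
      pairColor ψ (p τ.1 (f τ.1)) (p τ.2.1 (f τ.2.1))
        = pairColor ψ (p τ.2.2.1 (f τ.2.2.1)) (p τ.2.2.2 (f τ.2.2.2))})
    (fun τ => τ.2.2.2) hX (by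
      rintro ⟨a, b, z, w⟩ f
      by_cases hw : w ≠ a ∧ w ≠ b ∧ w ≠ z ∧ R z w
      · obtain ⟨ha, hb, hz, hR⟩ := hw
        have := h z w hz.symm hR (f z) (pairColor ψ (p a (f a)) (p b (f b)))
        simp only [Set.mem_ofPred_eq, Function.update_self, Function.update_of_ne ha.symm,
          Function.update_of_ne hb.symm, Function.update_of_ne hz.symm, Fintype.card_prod]
        convert! this using 2
        · ring
        · congr 1
          ext y
          simp [ha, hb, hz, hR, eq_comm]
      · convert! hX
        rw [mul_eq_zero, card_eq_zero, filter_eq_empty_iff]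
        refine Or.inr fun x _ hx => hw ⟨hx.1, hx.2.1, hx.2.2.1, hx.2.2.2.1⟩)
  exact ⟨f, fun a b z w ha hb hz hR heq => hf (a, b, z, w) ⟨ha, hb, hz, hR, heq⟩⟩

/-! ### Erdős–Rado canonical Ramsey theorem -/

open Classical in
/-- In a large vertex set there are `t` vertices on which no color repeats, or a sequence of `L`
vertices in which the color of a pair depends on its first vertex only. -/
theorem exists_rainbow_or_exists_sequence (ψ : TopEdgeLabeling V C) (t L : ℕ) (A : Finset V)
    (hA : (t ^ 4 + 1) ^ L ≤ #A) :
    (∃ f : Fin t → V, (∀ i, f i ∈ A) ∧ ∀ a b z w, w ≠ a → w ≠ b → w ≠ z →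
      pairColor ψ (f a) (f b) ≠ pairColor ψ (f z) (f w)) ∨
    ∃ (v : Fin L → V) (c : Fin L → C), (∀ i, v i ∈ A) ∧
      ∀ i j, i < j → pairColor ψ (v i) (v j) = some (c i) := by
  induction L generalizing A with
  | zero => exact Or.inr ⟨Fin.elim0, Fin.elim0, fun i => i.elim0, fun i => i.elim0⟩
  | succ L ih =>
    -- Either all color classes at every vertex of `A` are sparse and the union bound applies, or
    -- some `v` sends one color to a `1 / t ^ 4` share of `A`; then `v` starts the sequence and the
    -- search continues in that share.
    by_cases hstuck : ∀ v ∈ A, ∀ c, t ^ 4 * #{x ∈ A | pairColor ψ v x = c} < #A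
    · left
      obtain ⟨f, hf⟩ := exists_forall_pairColor_ne ψ (ι := Fin t) (X := A)
        (fun _ x => x) (fun _ _ => True)
        (by rw [Fintype.card_coe]; exact (pow_pos (Nat.succ_pos _) _).trans_le hA) (by
          intro z w _ _ x c
          rw [Fintype.card_fin, Fintype.card_coe]
          refine lt_of_eq_of_lt ?_ (hstuck x x.2 c)
          congr 1
          rw [← card_map (Function.Embedding.subtype _)]
          congr 1
          ext y
          simp [and_comm])
      exact ⟨fun i => f i, fun i => (f i).2,
        fun a b z w ha hb hz => hf a b z w ha hb hz trivial⟩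
    · push Not at hstuck
      obtain ⟨v, hv, c, hc⟩ := hstuck
      have hcard : (t ^ 4 + 1) ^ L ≤ #{x ∈ A | pairColor ψ v x = c} := by
        rw [pow_succ'] at hA
        refine Nat.le_of_mul_le_mul_left ((hA.trans hc).trans ?_) (Nat.succ_pos (t ^ 4))
        exact Nat.mul_le_mul_right _ (Nat.le_succ _)
      -- The value `none` is taken only at `v` itself; the `+ 1` in the base makes `A` too large for
      -- a single vertex to be such a share.
      obtain _ | c := c
      · have h1 : #{x ∈ A | pairColor ψ v x = none} ≤ 1 := by
          refine card_le_one.mpr fun x hx y hy => ?_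
          rw [mem_filter, pairColor_eq_none] at hx hy
          exact hx.2.symm.trans hy.2
        have h2 : t ^ 4 + 1 ≤ #A := (Nat.le_self_pow (Nat.succ_ne_zero L) _).trans hA
        have h3 := Nat.mul_le_mul_left (t ^ 4) h1
        omega
      · rcases ih _ hcard with ⟨f, hf, hf'⟩ | ⟨w, d, hw, hwd⟩
        · exact Or.inl ⟨f, fun i => (mem_filter.mp (hf i)).1, hf'⟩
        · right
          refine ⟨Fin.cons v w, Fin.cons c d, fun i => ?_, fun i j hij => ?_⟩
          · cases i using Fin.cases with
            | zero => simpa using hv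
            | succ i => simpa using (mem_filter.mp (hw i)).1
          · cases j using Fin.cases with
            | zero => exact absurd hij (Fin.not_lt_zero i)
            | succ j =>
              cases i using Fin.cases with
              | zero => simpa using (mem_filter.mp (hw j)).2
              | succ i => simpa using hwd i j (Fin.succ_lt_succ_iff.mp hij)

/-- **Erdős–Rado canonical Ramsey theorem** for pairs, finite version. -/
theorem exists_canonical_subset (ψ : TopEdgeLabeling V C) {t : ℕ} (ht : 1 ≤ t) (A : Finset V)
    (hA : (t ^ 4 + 1) ^ (t * t) ≤ #A) :
    ∃ S ⊆ A, #S = t ∧ (IsMonochromaticOn ψ (cliqueOn S) ∨ IsRainbowOn ψ (cliqueOn S) ∨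
      IsLexOn ψ S) := by
  classical
  rcases exists_rainbow_or_exists_sequence ψ t (t * t) A hA with
    ⟨f, hfA, hf⟩ | ⟨v, c, hvA, hvc⟩
  · have hinj : Function.Injective f := by
      -- A repeated vertex would give two pairs of value `none`, which `hf` also forbids.
      intro a b hab
      by_contra hne
      refine hf a a a b (Ne.symm hne) (Ne.symm hne) (Ne.symm hne) ?_
      rw [← hab]
    refine ⟨univ.map ⟨f, hinj⟩, fun x hx => ?_, by simp, Or.inr (Or.inl ?_)⟩
    · obtain ⟨i, -, rfl⟩ := mem_map.mp hx
      exact hfA i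
    · rw [isRainbowOn_iff]
      intro a b z w hab hzw heq
      obtain ⟨hab, ha, hb⟩ := cliqueOn_adj.mp hab
      obtain ⟨hzw, hz, hw⟩ := cliqueOn_adj.mp hzw
      obtain ⟨a, -, rfl⟩ := mem_map.mp ha
      obtain ⟨b, -, rfl⟩ := mem_map.mp hb
      obtain ⟨z, -, rfl⟩ := mem_map.mp hz
      obtain ⟨w, -, rfl⟩ := mem_map.mp hw
      simp only [Function.Embedding.coeFn_mk] at *
      have hzw' : z ≠ w := fun h => hzw (by rw [h])
      have h1 : w = a ∨ w = b := by
        by_contra! hcon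
        exact hf a b z w hcon.1 hcon.2 hzw'.symm heq
      have h2 : z = a ∨ z = b := by
        by_contra! hcon
        exact hf a b w z hcon.1 hcon.2 hzw' (heq.trans (pairColor_comm ψ _ _))
      rw [Sym2.eq_iff]
      rcases h1 with rfl | rfl <;> rcases h2 with rfl | rfl <;> simp_all
  · have hinj : Function.Injective v := by
      intro i j hij
      by_contra hne
      rcases lt_or_gt_of_ne hne with h | h
      · have := hvc i j h
        rw [pairColor_eq_none.mpr hij] at this
        cases this
      · have := hvc j i h
        rw [pairColor_eq_none.mpr hij.symm] at this
        cases this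
    -- Among `t * t` color labels, one occurs `t` times (monochromatic) or `t` are distinct (LEX).
    have hsub : (∃ I : Finset (Fin (t * t)), #I = t ∧ ∃ d, ∀ i ∈ I, c i = d) ∨
        ∃ I : Finset (Fin (t * t)), #I = t ∧ Set.InjOn c I := by
      by_cases him : t ≤ #(univ.image c)
      · right
        obtain ⟨D, hD, hDt⟩ := exists_subset_card_eq him
        obtain ⟨I, -, hI, rfl⟩ := exists_subset_injOn_image_eq_of_surjOn Set.univ D
          (f := c) (fun d hd => by
            obtain ⟨i, -, rfl⟩ := mem_image.mp (hD hd)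
            exact ⟨i, trivial, rfl⟩)
        exact ⟨I, by rwa [card_image_of_injOn hI] at hDt, hI⟩
      · left
        obtain ⟨d, -, hd⟩ := exists_le_card_fiber_of_mul_le_card_of_maps_to
          (s := univ) (t := univ.image c) (f := c) (n := t)
          (fun i _ => mem_image_of_mem _ (mem_univ i))
          (image_nonempty.mpr ⟨⟨0, Nat.mul_pos ht ht⟩, mem_univ _⟩)
          (by rw [card_univ, Fintype.card_fin]; exact Nat.mul_le_mul_right _ (by omega))
        obtain ⟨I, hI, hIt⟩ := exists_subset_card_eq hd
        exact ⟨I, hIt, d, fun i hi => (mem_filter.mp (hI hi)).2⟩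
    rcases hsub with ⟨I, hIt, d, hd⟩ | ⟨I, hIt, hI⟩
    · refine ⟨I.map ⟨v, hinj⟩, fun x hx => ?_, by simpa, Or.inl
        (isMonochromaticOn_cliqueOn (c := d) fun x hx y hy hxy => ?_)⟩
      · obtain ⟨i, -, rfl⟩ := mem_map.mp hx
        exact hvA i
      · obtain ⟨i, hi, rfl⟩ := mem_map.mp hx
        obtain ⟨j, hj, rfl⟩ := mem_map.mp hy
        have hij : i ≠ j := fun h => hxy (by rw [h])
        rcases lt_or_gt_of_ne hij with h | h
        · exact (hvc i j h).trans (by rw [hd i hi])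
        · rw [pairColor_comm]
          exact (hvc j i h).trans (by rw [hd j hj])
    · refine ⟨I.map ⟨v, hinj⟩, fun x hx => ?_, by simpa, Or.inr (Or.inr ?_)⟩
      · obtain ⟨i, -, rfl⟩ := mem_map.mp hx
        exact hvA i
      · let e := I.orderEmbOfFin hIt
        refine isLexOn_of_forall_lt (t := t) (by simpa) (fun i => v (e i.rev))
          (hinj.comp (e.injective.comp Fin.rev_injective)) ?_ (fun i => c (e i.rev)) ?_ ?_
        · have : Set.range (fun i : Fin t => v (e i.rev)) = v '' (Set.range e) := by
            rw [← Set.range_comp]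
            exact Fin.rev_surjective.range_comp (v ∘ e)
          rw [this, range_orderEmbOfFin]
          simp
        · intro i j hij
          have := hI (I.orderEmbOfFin_mem hIt _) (I.orderEmbOfFin_mem hIt _) hij
          exact Fin.rev_injective (e.injective this)
        · intro i j hij
          rw [pairColor_comm]
          exact hvc _ _ (e.strictMono (Fin.rev_lt_rev.mpr hij))

/-! ### Erdős–Stone and Turán bounds -/

/-- The Erdős–Stone theorem in the form of an upper bound on the extremal number. -/
theorem exists_extremalNumber_completeEquipartiteGraph_le {ε : ℝ} (hε : 0 < ε) (k s : ℕ) :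
    ∃ B : ℝ, ∀ᶠ n : ℕ in atTop, (extremalNumber n (completeEquipartiteGraph (k + 1) s) : ℝ)
      ≤ (1 - 1 / k + ε) * (n * (n + 1) / 2) + B := by
  obtain ⟨N, hN⟩ := eventually_atTop.mp
    (eventually_completeEquipartiteGraph_isContained_of_minDegree hε k s)
  set H := completeEquipartiteGraph (k + 1) s
  -- `B` makes the bound an equality at the threshold `N` of the minimum-degree version; the steps
  -- after `N` add up to the triangular number.
  refine ⟨extremalNumber N H - (1 - 1 / k + ε) * (N * (N + 1) / 2),
    eventually_atTop.mpr ⟨N, fun n hn => ?_⟩⟩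
  induction n, hn using Nat.le_induction with
  | base => linarith
  | succ n hn ih =>
    -- An `H`-free graph has a vertex of degree below the threshold; deleting it leaves an `H`-free
    -- graph on `n` vertices.
    have key : (extremalNumber (n + 1) H : ℝ)
        ≤ extremalNumber n H + (1 - 1 / k + ε) * (n + 1 : ℕ) := by
      have hnn : (0 : ℝ) ≤ extremalNumber n H + (1 - 1 / k + ε) * (n + 1 : ℕ) := by
        have : (1 : ℝ) / k ≤ 1 := by
          rw [one_div]; exact Nat.cast_inv_le_one k
        have : 0 ≤ (1 - 1 / k + ε : ℝ) := by linarith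
        positivity
      have hcard : Fintype.card (Fin (n + 1)) = n + 1 := Fintype.card_fin _
      rw [← hcard, extremalNumber_le_iff_of_nonneg H (by rwa [hcard]), hcard]
      intro G _ hG
      have hdeg : (G.minDegree : ℝ) < (1 - 1 / k + ε) * (n + 1 : ℕ) := by
        by_contra! hcon
        exact hG (hN (n + 1) (by omega) hcon)
      obtain ⟨v, hv⟩ := G.exists_minimal_degree_vertex
      have h1 := card_edgeFinset_deleteIncidenceSet_le_extremalNumber hG v
      rw [card_edgeFinset_deleteIncidenceSet, hcard, Nat.add_sub_cancel, ← hv] at h1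
      have h2 : #G.edgeFinset ≤ extremalNumber n H + G.minDegree := by omega
      have h3 : (#G.edgeFinset : ℝ) ≤ extremalNumber n H + G.minDegree := by exact_mod_cast h2
      linarith
    push_cast at key ⊢
    linarith

/-- The Turán graph attains this: the remainder `n % k` costs at most `k ^ 2 / 2` and rounding down
at most 1. -/
theorem le_extremalNumber_top (n k : ℕ) (hk : 1 ≤ k) :
    (1 - 1 / k) * (n ^ 2 / 2 : ℝ) - (k ^ 2 + 1)
      ≤ extremalNumber n (⊤ : SimpleGraph (Fin (k + 1))) := by
  have : Nontrivial (Fin (k + 1)) := Fin.nontrivial_iff_two_le.mpr (by omega)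
  rw [extremalNumber_top, Fintype.card_fin, Nat.add_sub_cancel, card_edgeFinset_turanGraph]
  have hk' : (0 : ℝ) < k := by exact_mod_cast hk
  have hm : n % k < k := Nat.mod_lt _ hk
  have hmn : n % k ≤ n := Nat.mod_le _ _
  have h1 := Nat.lt_div_mul_add (a := (n ^ 2 - (n % k) ^ 2) * (k - 1)) (b := 2 * k) (by omega)
  set q := (n ^ 2 - (n % k) ^ 2) * (k - 1) / (2 * k)
  have h2 : (((n ^ 2 - (n % k) ^ 2) * (k - 1) : ℕ) : ℝ) < ((q * (2 * k) + 2 * k : ℕ) : ℝ) := by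
    exact_mod_cast h1
  push_cast [Nat.cast_sub (Nat.pow_le_pow_left hmn 2), Nat.cast_sub hk] at h2
  have h3 : ((n % k : ℕ) : ℝ) ≤ k := by exact_mod_cast hm.le
  have h3' : ((n % k : ℕ) : ℝ) ^ 2 ≤ k ^ 2 := by gcongr
  have h4 : (0 : ℝ) ≤ (((n % k).choose 2 : ℕ) : ℝ) := by positivity
  have h5 : (1 : ℝ) ≤ k := by exact_mod_cast hk
  have h6 : ((n % k : ℕ) : ℝ) ^ 2 * (k - 1) ≤ k ^ 2 * k :=
    mul_le_mul h3' (by linarith) (by linarith) (by positivity)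
  have h7 : (1 - 1 / k) * (n ^ 2 / 2 : ℝ) = (n ^ 2 * (k - 1)) / (2 * k) := by
    field_simp
  push_cast
  rw [h7, sub_le_iff_le_add, div_le_iff₀ (by positivity)]
  nlinarith [mul_nonneg h4 hk'.le, pow_pos hk' 3]

/-- The upper bound for the blow-up and the lower bound for the clique share the leading coefficient
`(1 - 1 / k) / 2`, up to `ε / 2`. The difference is nonnegative because the blow-up contains the
clique. -/
theorem isLittleO_extremalNumber_sub (k s : ℕ) (hk : 1 ≤ k) (hs : 1 ≤ s) :
    (fun n : ℕ => (extremalNumber n (completeEquipartiteGraph (k + 1) s) : ℝ)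
      - extremalNumber n (⊤ : SimpleGraph (Fin (k + 1)))) =o[atTop] fun n : ℕ => (n : ℝ) ^ 2 := by
  rw [Asymptotics.isLittleO_iff]
  intro ε hε
  obtain ⟨B, hB⟩ := exists_extremalNumber_completeEquipartiteGraph_le hε k s
  have hlin : ∀ᶠ n : ℕ in atTop, (1 + ε) * n + 2 * (B + (k ^ 2 + 1)) ≤ ε * (n : ℝ) ^ 2 := by
    have h1 : ∀ᶠ n : ℕ in atTop, (1 + ε + 1) / ε ≤ (n : ℝ) :=
      tendsto_natCast_atTop_atTop.eventually_ge_atTop _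
    have h2 : ∀ᶠ n : ℕ in atTop, 2 * (B + (k ^ 2 + 1)) ≤ (n : ℝ) :=
      tendsto_natCast_atTop_atTop.eventually_ge_atTop _
    filter_upwards [h1, h2] with n h1 h2
    rw [div_le_iff₀ hε] at h1
    nlinarith [mul_le_mul_of_nonneg_left h1 (Nat.cast_nonneg (α := ℝ) n)]
  filter_upwards [hB, hlin] with n hB hlin
  have hle : extremalNumber n (⊤ : SimpleGraph (Fin (k + 1)))
      ≤ extremalNumber n (completeEquipartiteGraph (k + 1) s) := by
    refine IsContained.extremalNumber_le ⟨⟨⟨fun i => (i, ⟨0, hs⟩), fun h => ?_⟩, ?_⟩⟩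
    · exact completeEquipartiteGraph_adj.mpr h.ne
    · intro i j h
      exact congrArg Prod.fst h
  have hle' : (extremalNumber n (⊤ : SimpleGraph (Fin (k + 1))) : ℝ)
      ≤ extremalNumber n (completeEquipartiteGraph (k + 1) s) := by exact_mod_cast hle
  have hlow := le_extremalNumber_top n k hk
  rw [Real.norm_of_nonneg (by linarith), Real.norm_of_nonneg (by positivity)]
  have hk0 : (0 : ℝ) ≤ 1 / k := by positivity
  have : (1 - 1 / k + ε) * (n : ℝ) ≤ (1 + ε) * n := by gcongr; linarith
  nlinarith

/-! ### Rainbow multipartite subgraphs -/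

/-- A coloring with many colors contains a rainbow copy of any graph that is forced by as many
edges. -/
theorem exists_rainbow_copy {n : ℕ} {C W : Type*} (ψ : TopEdgeLabeling (Fin n) C)
    (H : SimpleGraph W) (h : extremalNumber n H < (colors ψ).ncard) :
    ∃ G : SimpleGraph (Fin n), IsRainbowOn ψ G ∧ H ⊑ G := by
  classical
  -- `σ` picks one edge of each color.
  choose σ hσ using fun c : colors ψ => c.2
  let E : Set (Sym2 (Fin n)) := Set.range fun c => (σ c : Sym2 (Fin n))
  have hE : (fromEdgeSet E).edgeSet = E := by
    rw [edgeSet_fromEdgeSet, sdiff_eq_left, Set.disjoint_left]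
    rintro _ ⟨c, rfl⟩
    exact not_isDiag_of_mem_edgeSet _ (σ c).2
  refine ⟨fromEdgeSet E, ?_, ?_⟩
  · rintro e he e' he' heq
    simp only [Set.mem_ofPred_eq, hE] at he he'
    obtain ⟨c, hc⟩ := he
    obtain ⟨d, hd⟩ := he'
    have hc := Subtype.ext hc
    have hd := Subtype.ext hd
    subst hc hd
    rw [hσ, hσ] at heq
    rw [Subtype.ext heq]
  · refine IsContained.of_extremalNumber_lt_card_edgeFinset ?_
    rw [Fintype.card_fin]
    have hinj : Function.Injective fun c => (σ c : Sym2 (Fin n)) := by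
      intro c d hcd
      have := congrArg ψ (Subtype.ext hcd)
      rw [hσ, hσ] at this
      exact Subtype.ext this
    rw [← Set.ncard_coe_finset, coe_edgeFinset, hE, ← Nat.card_coe_set_eq E,
      Nat.card_range_of_injective hinj]
    exact h

/-- A rainbow complete `r`-partite graph with large parts has a complete `r`-partite
subgraph with parts of size `m` no color of which appears inside a part. -/
theorem exists_subparts_avoiding {V C : Type*} (ψ : TopEdgeLabeling V C)
    {G : SimpleGraph V} (hG : IsRainbowOn ψ G) {r m q : ℕ} (hq : (r * m) ^ 4 < q)
    (F : Copy (completeEquipartiteGraph r (m * q)) G) :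
    ∃ W : Fin r → Finset V, (∀ i, #(W i) = m) ∧ (∀ i j, i ≠ j → Disjoint (W i) (W j)) ∧
      multipartiteOn W ≤ G ∧
      ∀ i, Disjoint (colorsOn ψ (multipartiteOn W)) (colorsOn ψ (cliqueOn (W i))) := by
  classical
  -- Each part is cut into `m` blocks of `q` vertices; a coordinate names a part and a block.
  let p : Fin r × Fin m → Fin q → V := fun a x => F (a.1, finProdFinEquiv (a.2, x))
  have hp : ∀ a b x y, p a x = p b y → a = b ∧ x = y := by
    intro a b x y h
    have := F.injective h
    rw [Prod.mk.injEq, finProdFinEquiv.injective.eq_iff, Prod.mk.injEq] at this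
    exact ⟨Prod.ext this.1 this.2.1, this.2.2⟩
  have hadj : ∀ a b x y, a.1 ≠ b.1 → G.Adj (p a x) (p b y) := fun a b x y h =>
    F.toHom.map_adj (completeEquipartiteGraph_adj.mpr h)
  obtain ⟨f, hf⟩ := exists_forall_pairColor_ne ψ p (fun z w => z.1 ≠ w.1)
    (by rw [Fintype.card_fin]; omega) (by
      intro z w _ hzw x c
      rw [Fintype.card_prod, Fintype.card_fin, Fintype.card_fin, Fintype.card_fin]
      -- As `G` is rainbow, a vertex sends at most one edge of a given color to a block of another
      -- part, so `q > (r * m) ^ 4` suffices.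
      refine lt_of_le_of_lt (Nat.mul_le_mul_left _ (card_le_one.mpr ?_)) (by simpa using hq)
      intro y hy y' hy'
      rw [mem_filter] at hy hy'
      have := isRainbowOn_iff.mp hG _ _ _ _ (hadj z w x y hzw) (hadj z w x y' hzw)
        (hy.2.trans hy'.2.symm)
      rw [Sym2.eq_iff] at this
      rcases this with h | h
      · exact (hp _ _ _ _ h.2).2
      · exact absurd (congrArg Prod.fst (hp _ _ _ _ h.1).1) hzw)
  let g : Fin r × Fin m → V := fun a => p a (f a)
  have hg : Function.Injective g := fun a b h => (hp _ _ _ _ h).1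
  have hW : ∀ i x, x ∈ univ.image (fun a => g (i, a)) ↔ ∃ a, g (i, a) = x := by simp
  refine ⟨fun i => univ.image fun a => g (i, a), fun i => ?_, fun i j hij => ?_, ?_, fun i => ?_⟩
  · exact (card_image_of_injective _ (hg.comp (Prod.mk_right_injective i))).trans
      (card_fin m)
  · rw [Finset.disjoint_left]
    intro x hx hy
    obtain ⟨a, rfl⟩ := (hW _ _).mp hx
    obtain ⟨b, hb⟩ := (hW _ _).mp hy
    exact hij (congrArg Prod.fst (hg hb)).symm
  · intro u v huv
    obtain ⟨-, i, j, hij, hu, hv⟩ := multipartiteOn_adj.mp huv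
    obtain ⟨a, rfl⟩ := (hW _ _).mp hu
    obtain ⟨b, rfl⟩ := (hW _ _).mp hv
    exact hadj _ _ _ _ hij
  · rw [Set.disjoint_left]
    rintro _ ⟨x, y, hxy, hadjxy, rfl⟩ ⟨u, v, huv, hadjuv, hc⟩
    obtain ⟨-, j, k, hjk, hx, hy⟩ := multipartiteOn_adj.mp hadjxy
    obtain ⟨-, hu, hv⟩ := cliqueOn_adj.mp hadjuv
    obtain ⟨b, rfl⟩ := (hW _ _).mp hx
    obtain ⟨d, rfl⟩ := (hW _ _).mp hy
    obtain ⟨a, rfl⟩ := (hW _ _).mp hu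
    obtain ⟨a', rfl⟩ := (hW _ _).mp hv
    have heq : pairColor ψ (g (i, a)) (g (i, a')) = pairColor ψ (g (j, b)) (g (k, d)) := by
      rw [pairColor_of_ne ψ huv, pairColor_of_ne ψ hxy, hc]
    -- A crossing edge has an end outside part `i`, hence off the inner edge; that end plays the
    -- role of `w`.
    by_cases hki : k = i
    · have hji : j ≠ i := fun h => hjk (h.trans hki.symm)
      exact hf (i, a) (i, a') (k, d) (j, b) (fun h => hji (congrArg Prod.fst h))
        (fun h => hji (congrArg Prod.fst h)) (fun h => hjk (congrArg Prod.fst h)) hjk.symm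
        (heq.trans (pairColor_comm ψ _ _))
    · exact hf (i, a) (i, a') (j, b) (k, d) (fun h => hki (congrArg Prod.fst h))
        (fun h => hki (congrArg Prod.fst h)) (fun h => hjk (congrArg Prod.fst h).symm) hjk heq

theorem colorsOn_mono {V C : Type*} (ψ : TopEdgeLabeling V C) {H K : SimpleGraph V} (h : H ≤ K) :
    colorsOn ψ H ⊆ colorsOn ψ K := by
  rintro _ ⟨u, v, huv, hadj, rfl⟩
  exact ⟨u, v, huv, h hadj, rfl⟩

theorem multipartiteOn_mono {V ι : Type*} {P Q : ι → Finset V} (h : ∀ i, P i ⊆ Q i) :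
    multipartiteOn P ≤ multipartiteOn Q := by
  intro u v huv
  obtain ⟨hne, i, j, hij, hu, hv⟩ := multipartiteOn_adj.mp huv
  exact multipartiteOn_adj.mpr ⟨hne, i, j, hij, h i hu, h j hv⟩

theorem cliqueOn_mono {V : Type*} {S T : Finset V} (h : S ⊆ T) : cliqueOn S ≤ cliqueOn T := by
  intro u v huv
  obtain ⟨hne, hu, hv⟩ := cliqueOn_adj.mp huv
  exact cliqueOn_adj.mpr ⟨hne, h hu, h hv⟩

end CanonicalCut

/-! ### The Canonical Cut Lemma -/

theorem theoremt (r t : ℕ) (hr : 2 ≤ r) (ht : 2 ≤ t) :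
    ∃ h : ℕ → ℝ,
      Asymptotics.IsLittleO Filter.atTop h (fun n : ℕ => (n : ℝ) ^ 2) ∧
      ∀ (n : ℕ) (C : Type*) (ψ : SimpleGraph.TopEdgeLabeling (Fin n) C),
        (SimpleGraph.extremalNumber n (⊤ : SimpleGraph (Fin r)) : ℝ) + h n
            < ((CanonicalCut.colors ψ).ncard : ℝ) →
        ∃ P : Fin r → Finset (Fin n),
          (∀ i, (P i).card = t) ∧
          (∀ i j, i ≠ j → Disjoint (P i) (P j)) ∧
          CanonicalCut.IsRainbowOn ψ (CanonicalCut.multipartiteOn P) ∧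
          (∀ i,
            CanonicalCut.IsMonochromaticOn ψ (CanonicalCut.cliqueOn (P i)) ∨
            CanonicalCut.IsRainbowOn ψ (CanonicalCut.cliqueOn (P i)) ∨
            CanonicalCut.IsLexOn ψ (P i)) ∧
          (∀ i, Disjoint
            (CanonicalCut.colorsOn ψ (CanonicalCut.multipartiteOn P))
            (CanonicalCut.colorsOn ψ (CanonicalCut.cliqueOn (P i)))) := by
  classical
  obtain ⟨k, rfl⟩ : ∃ k, r = k + 1 := ⟨r - 1, by omega⟩
  -- `m` is the Erdős–Rado bound for `t`, and `q` the block size needed to clean parts down to `m`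
  -- vertices.
  set m := (t ^ 4 + 1) ^ (t * t)
  set q := ((k + 1) * m) ^ 4 + 1
  have hs : 1 ≤ m * q := Nat.mul_pos (pow_pos (Nat.succ_pos _) _) (Nat.succ_pos _)
  refine ⟨_, CanonicalCut.isLittleO_extremalNumber_sub k (m * q) (by omega) hs, ?_⟩
  intro n C ψ hcol
  rw [add_sub_cancel, Nat.cast_lt] at hcol
  obtain ⟨G, hG, ⟨F⟩⟩ := CanonicalCut.exists_rainbow_copy ψ _ hcol
  obtain ⟨W, hWm, hWd, hWG, hWc⟩ :=
    CanonicalCut.exists_subparts_avoiding ψ hG (Nat.lt_succ_self _) F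
  choose P hPW hPt hP using fun i =>
    CanonicalCut.exists_canonical_subset ψ (t := t) (by omega) (W i) (hWm i).ge
  have hle := CanonicalCut.multipartiteOn_mono hPW
  exact ⟨P, hPt, fun i j hij => (hWd i j hij).mono (hPW i) (hPW j),
    hG.mono (hle.trans hWG), hP, fun i => (hWc i).mono (CanonicalCut.colorsOn_mono ψ hle)
      (CanonicalCut.colorsOn_mono ψ (CanonicalCut.cliqueOn_mono (hPW i)))⟩
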